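/- Let $K$ be a field and let $E=(E^0,E^1,r,s)$ be an arbitrary directed graph, with vertex set $E^0$, edge set $E^1$, and source and range maps $s,r:E^1\to E^0$ (vertices may emit infinitely many edges). The Leavitt path algebra $L_K(E)$ is the (not necessarily unital) associative $K$-algebra generated by pairwise orthogonal idempotents $v\in E^0$ together with elements $e,e^*$ ($e\in E^1$), subject to the relations $s(e)e=e\,r(e)=e$ and $r(e)e^*=e^*s(e)=e^*$ for all $e\in E^1$; $e^*f=\delta_{e,f}\,r(e)$ for all $e,f\in E^1$; and $v=\sum_{s(e)=v}ee^*$ for every vertex $v$ which emits a nonzero finite number of edges. The socle of $L_K(E)$ is the sum of all its minimal left ideals (it is $0$ if there are none). A vertex $u$ is called a line point if no vertex $w$ for which there is a path (possibly of length $0$) from $u$ to $w$ emits two or more edges or is the base of a cycle, a cycle being a closed path $e_1\cdots e_n$ with $n\ge 1$ and $s(e_i)\ne s(e_j)$ for $i\neq j$. Then $L_K(E)$ has nonzero socle if and only if $E$ has a line point. -/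

import Mathlib

open scoped MonoidAlgebra

/-- A directed graph with set of vertices `V`, set of edges `E`, and source and range maps
`s, r : E → V`. Loops and multiple edges are allowed, and there is no restriction on the
cardinalities of `V` and `E`. -/
structure DirGraph (V E : Type*) where
  /-- the source of an edge -/
  s : E → V
  /-- the range of an edge -/
  r : E → V

namespace DirGraph

variable {V E : Type*} (G : DirGraph V E)

/-- A vertex is a sink if it emits no edges. -/
def IsSink (v : V) : Prop := G.s ⁻¹' {v} = ∅

/-- A vertex is an infinite emitter if it emits infinitely many edges. -/
def IsInfiniteEmitter (v : V) : Prop := (G.s ⁻¹' {v}).Infinite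

/-- A vertex is regular if it is neither a sink nor an infinite emitter. -/
def IsRegular (v : V) : Prop := ¬ G.IsSink v ∧ ¬ G.IsInfiniteEmitter v

/-- `G.IsPath v p w`: the list of edges `p = [e₁, …, eₙ]` is a path with source `v` and range `w`;
the empty list is the path of length `0` at `v` (so then `w = v`). -/
def IsPath : V → List E → V → Prop
  | v, [], w => v = w
  | v, e :: p, w => G.s e = v ∧ IsPath (G.r e) p w

/-- The tree of `v`: the vertices at which some path starting at `v` ends. -/
def tree (v : V) : Set V := {w | ∃ p, G.IsPath v p w}

/-- A cycle based at `v`: a closed path of positive length which starts and ends at `v` and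
whose edges have pairwise different sources. -/
def IsCycleAt (v : V) (p : List E) : Prop :=
  p ≠ [] ∧ G.IsPath v p v ∧ (p.map G.s).Nodup

/-- There is a bifurcation at `v` if `v` emits at least two edges. -/
def IsBifurcation (v : V) : Prop := (G.s ⁻¹' {v}).Nontrivial

/-- The set of line points: the vertices `u` such that there are neither bifurcations nor cycles
at any vertex of the tree of `u`. -/
def linePoints : Set V :=
  {u | ∀ w ∈ G.tree u, ¬ G.IsBifurcation w ∧ ¬ ∃ p, G.IsCycleAt w p}

end DirGraph

/-! ### Leavitt path algebras -/

/-- The generators of a Leavitt path algebra: the vertices `v`, the real edges `e`, and the ghost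
edges `e*`. -/
inductive LeavittGen (V E : Type*) where
  | vertex (v : V)
  | edge (e : E)
  | ghost (e : E)

/-- The free associative, not necessarily unital, `K`-algebra on a type `X`: its basis is the set of
nonempty words in `X`. -/
abbrev FreeNonUnitalAlg (K X : Type*) [Field K] : Type _ := K[FreeSemigroup X]

noncomputable section

namespace Leavitt

variable (K : Type*) [Field K] {V E : Type*} (G : DirGraph V E)

/-- a vertex as an element of the free algebra -/
abbrev fv (v : V) : FreeNonUnitalAlg K (LeavittGen V E) :=
  MonoidAlgebra.single (FreeSemigroup.of (.vertex v)) 1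

/-- a real edge as an element of the free algebra -/
abbrev fe (e : E) : FreeNonUnitalAlg K (LeavittGen V E) :=
  MonoidAlgebra.single (FreeSemigroup.of (.edge e)) 1

/-- a ghost edge as an element of the free algebra -/
abbrev fg (e : E) : FreeNonUnitalAlg K (LeavittGen V E) :=
  MonoidAlgebra.single (FreeSemigroup.of (.ghost e)) 1

/-- The defining relations of the Leavitt path algebra, and (constructor `smul`) their scalar
multiples, so that the ring congruence which they generate is a congruence of `K`-algebras. -/
inductive Rel : FreeNonUnitalAlg K (LeavittGen V E) → FreeNonUnitalAlg K (LeavittGen V E) → Prop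
  | vertex_idem (v : V) : Rel (fv K v * fv K v) (fv K v)
  | vertex_orth (v w : V) (h : v ≠ w) : Rel (fv K v * fv K w) 0
  | source_edge (e : E) : Rel (fv K (G.s e) * fe K e) (fe K e)
  | edge_range (e : E) : Rel (fe K e * fv K (G.r e)) (fe K e)
  | range_ghost (e : E) : Rel (fv K (G.r e) * fg K e) (fg K e)
  | ghost_source (e : E) : Rel (fg K e * fv K (G.s e)) (fg K e)
  | ghost_edge (e : E) : Rel (fg K e * fe K e) (fv K (G.r e))
  | ghost_edge_ne (e f : E) (h : e ≠ f) : Rel (fg K e * fe K f) 0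
  | regular (v : V) (h : G.IsRegular v) :
      Rel (fv K v) (∑ e ∈ (Set.not_infinite.mp h.2).toFinset, fe K e * fg K e)
  | smul (c : K) {x y : FreeNonUnitalAlg K (LeavittGen V E)} (h : Rel x y) : Rel (c • x) (c • y)

theorem smul_ringCon (c : K) {x y : FreeNonUnitalAlg K (LeavittGen V E)}
    (h : ringConGen (Rel K G) x y) : ringConGen (Rel K G) (c • x) (c • y) := by
  change RingConGen.Rel (Rel K G) x y at h
  change RingConGen.Rel (Rel K G) (c • x) (c • y)
  induction h with
  | of x y h => exact .of _ _ (.smul c h)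
  | refl x => exact .refl _
  | symm _ ih => exact ih.symm
  | trans _ _ ih₁ ih₂ => exact ih₁.trans ih₂
  | add _ _ ih₁ ih₂ => rw [smul_add, smul_add]; exact ih₁.add ih₂
  | mul _ h₂ ih₁ _ => rw [← smul_mul_assoc, ← smul_mul_assoc]; exact ih₁.mul h₂

end Leavitt

/-- The Leavitt path algebra `L_K(G)`: the quotient of the free associative `K`-algebra on the
vertices, the real edges and the ghost edges by the ideal of the defining relations. It has a unit
only if there are finitely many vertices. -/
def LeavittPathAlgebra (K : Type*) [Field K] {V E : Type*} (G : DirGraph V E) : Type _ :=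
  (ringConGen (Leavitt.Rel K G)).Quotient

namespace LeavittPathAlgebra

variable (K : Type*) [Field K] {V E : Type*} (G : DirGraph V E)

instance : NonUnitalRing (LeavittPathAlgebra K G) :=
  inferInstanceAs (NonUnitalRing (ringConGen (Leavitt.Rel K G)).Quotient)

/-- The quotient map from the free algebra. -/
def mk (x : FreeNonUnitalAlg K (LeavittGen V E)) : LeavittPathAlgebra K G :=
  RingCon.toQuotient (c := ringConGen (Leavitt.Rel K G)) x

instance : SMul K (LeavittPathAlgebra K G) where
  smul c := Quotient.map (c • ·) fun _ _ h => Leavitt.smul_ringCon K G c h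

instance : Module K (LeavittPathAlgebra K G) where
  one_smul := Quotient.ind fun x => congrArg (mk K G) (one_smul K x)
  mul_smul a b := Quotient.ind fun x => congrArg (mk K G) (mul_smul a b x)
  smul_zero a := congrArg (mk K G) (smul_zero a)
  smul_add a := Quotient.ind₂ fun x y => congrArg (mk K G) (smul_add a x y)
  add_smul a b := Quotient.ind fun x => congrArg (mk K G) (add_smul a b x)
  zero_smul := Quotient.ind fun x => congrArg (mk K G) (zero_smul K x)

instance : IsScalarTower K (LeavittPathAlgebra K G) (LeavittPathAlgebra K G) where
  smul_assoc a := Quotient.ind₂ fun x y => congrArg (mk K G) (smul_mul_assoc a x y)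

instance : SMulCommClass K (LeavittPathAlgebra K G) (LeavittPathAlgebra K G) where
  smul_comm a := Quotient.ind₂ fun x y => congrArg (mk K G) (mul_smul_comm a x y).symm

end LeavittPathAlgebra

end

/-! ### The socle of a not necessarily unital ring -/

section Socle

variable {R : Type*} [NonUnitalRing R]

/-- Left ideals of a not necessarily unital ring. -/
def IsLeftIdeal (I : AddSubgroup R) : Prop := ∀ (a : R), ∀ x ∈ I, a * x ∈ I

/-- Minimal left ideals: nonzero left ideals `I` such that the only left ideals contained in `I`
are `0` and `I`. -/
def IsMinimalLeftIdeal (I : AddSubgroup R) : Prop :=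
  IsLeftIdeal I ∧ I ≠ ⊥ ∧ ∀ J : AddSubgroup R, IsLeftIdeal J → J ≤ I → J = ⊥ ∨ J = I

/-- The (left) socle: the sum of all minimal left ideals. For a semiprime ring, such as a Leavitt
path algebra, it is also the sum of all minimal right ideals. -/
def ringSocle (R : Type*) [NonUnitalRing R] : AddSubgroup R :=
  sSup {I : AddSubgroup R | IsMinimalLeftIdeal I}

end Socle

/-! Every nonzero element x can be moved to a simple form by multiplying on both sides. A real path
on the right removes the ghost edges (`exists_mul_real_eq_comb`). Stripping a shortest path on the
left then leaves closed paths at one vertex w, with nonzero scalar part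
(`IsPathComb.exists_isClosedComb`). While the tree of w has a bifurcation, conjugation by a path
discards some closed path (`IsClosedComb.exists_card_lt`). The outcome is a multiple of a vertex, or
a combination at a vertex whose tree has no bifurcation.

A nonzero right translate of a minimal left ideal is again minimal, so some minimal left ideal
contains the reduced element. If the tree of w has no bifurcation but w carries a nontrivial closed
path q, this is impossible: in a representation over K[T,T⁻¹] (`exists_rep`) the element w - q acts
on a basis vector as 1 - T^n, which is not a unit (`IsClosedComb.ne_mul`). So a minimal left ideal
contains a vertex. That vertex is a line point: a cycle is excluded in the same way, a bifurcation
by the orthogonality of ee* and f.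

Conversely, paths p from a line point v satisfy pp* = v. The reduction of a nonzero x in Lv ends in
a multiple of a vertex, and conjugating back by p recovers v from x, so Lv is minimal. -/

namespace DirGraph

variable {V E : Type*} {G : DirGraph V E}

/-! ### Paths and cycles in a graph. -/

theorem IsPath.append {u v w : V} {p q : List E} (hp : G.IsPath u p v) (hq : G.IsPath v q w) :
    G.IsPath u (p ++ q) w := by
  induction p generalizing u with
  | nil => cases hp; exact hq
  | cons e p ih => exact ⟨hp.1, ih hp.2⟩

theorem IsPath.of_append {u w : V} {p q : List E} (h : G.IsPath u (p ++ q) w) :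
    ∃ v, G.IsPath u p v ∧ G.IsPath v q w := by
  induction p generalizing u with
  | nil => exact ⟨u, rfl, h⟩
  | cons e p ih =>
    obtain ⟨v, hv, hq⟩ := ih h.2
    exact ⟨v, ⟨h.1, hv⟩, hq⟩

theorem self_mem_tree (v : V) : v ∈ G.tree v := ⟨[], rfl⟩

theorem tree_subset {u v : V} (h : v ∈ G.tree u) : G.tree v ⊆ G.tree u := by
  obtain ⟨p, hp⟩ := h
  rintro w ⟨q, hq⟩
  exact ⟨p ++ q, hp.append hq⟩

theorem range_mem_tree (e : E) : G.r e ∈ G.tree (G.s e) := ⟨[e], rfl, rfl⟩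

/-- A path that visits a vertex twice contains a shorter closed path. -/
theorem exists_closed_of_not_nodup {u w : V} {p : List E} (hp : G.IsPath u p w)
    (h : ¬ (p.map G.s).Nodup) :
    ∃ x ∈ G.tree u, ∃ q, q ≠ [] ∧ G.IsPath x q x ∧ q.length < p.length := by
  induction p generalizing u with
  | nil => simp at h
  | cons e p ih =>
    rw [List.map_cons, List.nodup_cons, not_and_or, not_not] at h
    rcases h with h | h
    · obtain ⟨f, hf, hs⟩ := List.mem_map.mp h
      obtain ⟨p₁, p₂, rfl⟩ := List.append_of_mem hf
      obtain ⟨x, hx, hx'⟩ := hp.2.of_append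
      refine ⟨u, self_mem_tree u, e :: p₁, by simp, ⟨hp.1, ?_⟩, by simp⟩
      rwa [← hp.1, ← hs, hx'.1]
    · obtain ⟨x, hx, q, hq, hq', hl⟩ := ih hp.2 h
      refine ⟨x, tree_subset ?_ hx, q, hq, hq', hl.trans (by simp)⟩
      rw [← hp.1]
      exact range_mem_tree e

/-- Descent on length: a closed path with a repeated source yields a strictly shorter one in the
same tree. -/
theorem exists_cycle_of_closed {u : V} {p : List E} (h₀ : p ≠ []) (hp : G.IsPath u p u) :
    ∃ w ∈ G.tree u, ∃ q, G.IsCycleAt w q := by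
  induction hn : p.length using Nat.strong_induction_on generalizing u p with
  | _ n ih =>
    by_cases h : (p.map G.s).Nodup
    · exact ⟨u, self_mem_tree u, p, h₀, hp, h⟩
    · obtain ⟨x, hx, q, hq, hq', hl⟩ := exists_closed_of_not_nodup hp h
      obtain ⟨w, hw, hc⟩ := ih q.length (hn ▸ hl) hq hq' rfl
      exact ⟨w, tree_subset hx hw, hc⟩

theorem eq_of_not_isBifurcation {v : V} (h : ¬ G.IsBifurcation v) {e f : E} (he : G.s e = v)
    (hf : G.s f = v) : e = f :=
  (Set.not_nontrivial_iff.mp h) he hf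

end DirGraph

/-! ### Generators, relations and the universal property. -/

noncomputable section

namespace LeavittPathAlgebra

variable (K : Type*) [Field K] {V E : Type*} (G : DirGraph V E)

/-- A vertex as an element of the Leavitt path algebra. -/
def vx (v : V) : LeavittPathAlgebra K G := mk K G (Leavitt.fv K v)

/-- A real edge as an element of the Leavitt path algebra. -/
def ed (e : E) : LeavittPathAlgebra K G := mk K G (Leavitt.fe K e)

/-- A ghost edge as an element of the Leavitt path algebra. -/
def gh (e : E) : LeavittPathAlgebra K G := mk K G (Leavitt.fg K e)

variable {K G}

theorem mk_mul (x y : FreeNonUnitalAlg K (LeavittGen V E)) :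
    mk K G (x * y) = mk K G x * mk K G y := rfl

theorem mk_add (x y : FreeNonUnitalAlg K (LeavittGen V E)) :
    mk K G (x + y) = mk K G x + mk K G y := rfl

theorem mk_smul (c : K) (x : FreeNonUnitalAlg K (LeavittGen V E)) :
    mk K G (c • x) = c • mk K G x := rfl

theorem mk_zero : mk K G 0 = 0 := rfl

theorem mk_surjective : Function.Surjective (mk K G) := Quotient.mk_surjective

theorem mk_eq_of_rel {x y : FreeNonUnitalAlg K (LeavittGen V E)} (h : Leavitt.Rel K G x y) :
    mk K G x = mk K G y :=
  Quotient.sound (RingConGen.Rel.of _ _ h)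

theorem mk_sum {ι : Type*} (t : Finset ι) (f : ι → FreeNonUnitalAlg K (LeavittGen V E)) :
    mk K G (∑ i ∈ t, f i) = ∑ i ∈ t, mk K G (f i) :=
  map_sum (⟨⟨mk K G, mk_zero⟩, mk_add⟩ : _ →+ LeavittPathAlgebra K G) f t

@[simp] theorem vx_mul_self (v : V) : vx K G v * vx K G v = vx K G v :=
  mk_eq_of_rel (.vertex_idem v)

theorem vx_mul_of_ne {v w : V} (h : v ≠ w) : vx K G v * vx K G w = 0 :=
  mk_eq_of_rel (.vertex_orth v w h)

@[simp] theorem vx_mul_ed (e : E) : vx K G (G.s e) * ed K G e = ed K G e :=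
  mk_eq_of_rel (.source_edge e)

@[simp] theorem ed_mul_vx (e : E) : ed K G e * vx K G (G.r e) = ed K G e :=
  mk_eq_of_rel (.edge_range e)

@[simp] theorem vx_mul_gh (e : E) : vx K G (G.r e) * gh K G e = gh K G e :=
  mk_eq_of_rel (.range_ghost e)

@[simp] theorem gh_mul_vx (e : E) : gh K G e * vx K G (G.s e) = gh K G e :=
  mk_eq_of_rel (.ghost_source e)

@[simp] theorem gh_mul_ed (e : E) : gh K G e * ed K G e = vx K G (G.r e) :=
  mk_eq_of_rel (.ghost_edge e)

theorem gh_mul_ed_of_ne {e f : E} (h : e ≠ f) : gh K G e * ed K G f = 0 :=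
  mk_eq_of_rel (.ghost_edge_ne e f h)

theorem vx_eq_sum {v : V} (h : G.IsRegular v) :
    vx K G v = ∑ e ∈ (Set.not_infinite.mp h.2).toFinset, ed K G e * gh K G e :=
  (mk_eq_of_rel (.regular v h)).trans (mk_sum _ _)

theorem gh_mul_vx_of_ne {e : E} {v : V} (h : G.s e ≠ v) : gh K G e * vx K G v = 0 := by
  rw [← gh_mul_vx, mul_assoc, vx_mul_of_ne h, mul_zero]

theorem vx_mul_ed_of_ne {e : E} {v : V} (h : v ≠ G.s e) : vx K G v * ed K G e = 0 := by
  rw [← vx_mul_ed, ← mul_assoc, vx_mul_of_ne h, zero_mul]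

/-- Induction over the generators: a submodule which contains the generators and is
closed under right multiplication by them is everything. -/
theorem mem_of_gen_mem (D : Submodule K (LeavittPathAlgebra K G))
    (hv : ∀ v, vx K G v ∈ D) (he : ∀ e, ed K G e ∈ D) (hg : ∀ e, gh K G e ∈ D)
    (mv : ∀ x ∈ D, ∀ v, x * vx K G v ∈ D) (me : ∀ x ∈ D, ∀ e, x * ed K G e ∈ D)
    (mg : ∀ x ∈ D, ∀ e, x * gh K G e ∈ D) (x : LeavittPathAlgebra K G) : x ∈ D := by
  obtain ⟨x, rfl⟩ := mk_surjective x
  have gen : ∀ g : LeavittGen V E,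
      mk K G (MonoidAlgebra.single (FreeSemigroup.of g) 1) ∈ D ∧
      ∀ y ∈ D, y * mk K G (MonoidAlgebra.single (FreeSemigroup.of g) 1) ∈ D := by
    rintro (v | e | e)
    · exact ⟨hv v, fun y hy => mv y hy v⟩
    · exact ⟨he e, fun y hy => me y hy e⟩
    · exact ⟨hg e, fun y hy => mg y hy e⟩
  -- The second conjunct lets the induction absorb a word letter by letter from the left, although
  -- `D` is only closed under right multiplication by generators.
  have word : ∀ w : FreeSemigroup (LeavittGen V E),
      mk K G (MonoidAlgebra.single w 1) ∈ D ∧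
      ∀ y ∈ D, y * mk K G (MonoidAlgebra.single w 1) ∈ D := by
    intro w
    induction w using FreeSemigroup.recOnMul with
    | ih1 g => exact gen g
    | ih2 g w _ ih =>
      have : mk K G (MonoidAlgebra.single (FreeSemigroup.of g * w) 1) =
          mk K G (MonoidAlgebra.single (FreeSemigroup.of g) 1) *
            mk K G (MonoidAlgebra.single w 1) := by
        rw [← mk_mul, MonoidAlgebra.single_mul_single, mul_one]
      rw [this]
      refine ⟨ih.2 _ (gen g).1, fun y hy => ?_⟩
      rw [← mul_assoc]
      exact ih.2 _ ((gen g).2 y hy)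
  induction x using MonoidAlgebra.induction_linear with
  | zero => exact D.zero_mem
  | add x y hx hy => exact D.add_mem hx hy
  | single w c =>
    have : MonoidAlgebra.single w c = c • MonoidAlgebra.single w (1 : K) := by simp
    rw [this, mk_smul]
    exact D.smul_mem _ (word w).1

/-- The homomorphism on the free algebra which extends an assignment of the generators. -/
def freeLift (K : Type*) [Field K] {B : Type*} [NonUnitalRing B] [Module K B] [IsScalarTower K B B]
    [SMulCommClass K B B] (a : LeavittGen V E → B) : FreeNonUnitalAlg K (LeavittGen V E) →ₙₐ[K] B :=
  MonoidAlgebra.liftMagma K (FreeSemigroup.lift a)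

section Lift

variable {B : Type*} [NonUnitalRing B] [Module K B] [IsScalarTower K B B] [SMulCommClass K B B]
  (a : LeavittGen V E → B)

theorem freeLift_gen (g : LeavittGen V E) :
    freeLift K a (MonoidAlgebra.single (FreeSemigroup.of g) 1) = a g := by
  simp [freeLift, MonoidAlgebra.liftMagma_apply_apply]

/-- The universal property: assignments of the generators compatible with the relations extend. -/
def lift (h : ∀ x y, Leavitt.Rel K G x y → freeLift K a x = freeLift K a y) :
    LeavittPathAlgebra K G →ₙ+* B where
  toFun := Quotient.lift (freeLift K a) fun x y hxy => by
    change RingConGen.Rel (Leavitt.Rel K G) x y at hxy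
    induction hxy with
    | of x y h' => exact h x y h'
    | refl x => rfl
    | symm _ ih => exact ih.symm
    | trans _ _ ih₁ ih₂ => exact ih₁.trans ih₂
    | add _ _ ih₁ ih₂ => rw [map_add, map_add, ih₁, ih₂]
    | mul _ _ ih₁ ih₂ => rw [map_mul, map_mul, ih₁, ih₂]
  map_mul' := Quotient.ind₂ fun x y => map_mul (freeLift K a) x y
  map_zero' := map_zero (freeLift K a)
  map_add' := Quotient.ind₂ fun x y => map_add (freeLift K a) x y

theorem lift_mk (h) (x : FreeNonUnitalAlg K (LeavittGen V E)) :
    lift (G := G) a h (mk K G x) = freeLift K a x := rfl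

theorem lift_smul (h) (c : K) (x : LeavittPathAlgebra K G) :
    lift a h (c • x) = c • lift a h x := by
  obtain ⟨x, rfl⟩ := mk_surjective x
  rw [← mk_smul, lift_mk, lift_mk, map_smul]

end Lift

end LeavittPathAlgebra

end

/-! ### Path monomials and the reduction of combinations of real paths. -/

noncomputable section

namespace LeavittPathAlgebra

variable (K : Type*) [Field K] {V E : Type*} (G : DirGraph V E)

/-- The monomial of a path with range `w`. -/
def real (p : List E) (w : V) : LeavittPathAlgebra K G :=
  p.foldr (fun e x => ed K G e * x) (vx K G w)

/-- The monomial of the ghost of a path with range `w`. -/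
def ghost : List E → V → LeavittPathAlgebra K G
  | [], w => vx K G w
  | e :: p, w => ghost p w * gh K G e

/-- Linear combinations of real paths with range `w`. -/
def comb (w : V) : (List E →₀ K) →ₗ[K] LeavittPathAlgebra K G :=
  Finsupp.linearCombination K fun p => real K G p w

variable {K G}

@[simp] theorem real_nil (w : V) : real K G [] w = vx K G w := rfl

@[simp] theorem real_cons (e : E) (p : List E) (w : V) :
    real K G (e :: p) w = ed K G e * real K G p w := rfl

@[simp] theorem ghost_nil (w : V) : ghost K G [] w = vx K G w := rfl

@[simp] theorem ghost_cons (e : E) (p : List E) (w : V) :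
    ghost K G (e :: p) w = ghost K G p w * gh K G e := rfl

theorem comb_apply (w : V) (c : List E →₀ K) :
    comb K G w c = ∑ p ∈ c.support, c p • real K G p w := Finsupp.linearCombination_apply _ _

theorem vx_mul_real {u w : V} {p : List E} (h : G.IsPath u p w) :
    vx K G u * real K G p w = real K G p w := by
  cases p with
  | nil => cases h; simp
  | cons e p => rw [real_cons, ← mul_assoc, ← h.1, vx_mul_ed]

theorem vx_mul_real_of_ne {u v w : V} {p : List E} (h : G.IsPath u p w) (hv : v ≠ u) :
    vx K G v * real K G p w = 0 := by
  rw [← vx_mul_real h, ← mul_assoc, vx_mul_of_ne hv, zero_mul]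

@[simp] theorem real_mul_vx (p : List E) (w : V) :
    real K G p w * vx K G w = real K G p w := by
  induction p with
  | nil => simp
  | cons e p ih => rw [real_cons, mul_assoc, ih]

theorem real_mul_vx_of_ne (p : List E) {v w : V} (h : w ≠ v) :
    real K G p w * vx K G v = 0 := by
  rw [← real_mul_vx, mul_assoc, vx_mul_of_ne h, mul_zero]

theorem real_mul_real {u w : V} (p : List E) {q : List E} (h : G.IsPath u q w) :
    real K G p u * real K G q w = real K G (p ++ q) w := by
  induction p with
  | nil => exact vx_mul_real h
  | cons e p ih => rw [real_cons, mul_assoc, ih]; rfl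

theorem ghost_mul_real_append {u v w : V} {p q : List E} (hp : G.IsPath u p v)
    (hq : G.IsPath v q w) : ghost K G p v * real K G (p ++ q) w = real K G q w := by
  induction p generalizing u with
  | nil => exact vx_mul_real hq
  | cons e p ih =>
    rw [ghost_cons, List.cons_append, real_cons, mul_assoc, ← mul_assoc (gh K G e), gh_mul_ed,
      vx_mul_real (hp.2.append hq), ih hp.2]

theorem ghost_mul_real_self {u v : V} {p : List E} (hp : G.IsPath u p v) :
    ghost K G p v * real K G p v = vx K G v := by
  simpa using ghost_mul_real_append (K := K) hp (q := []) rfl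

/-- The length bound rules out that p' is a proper initial segment of p, in which case the product
would be a nonzero ghost path. Asking that q be a path from v matters for empty p, where the lists
alone do not see the base vertex. -/
theorem ghost_mul_real_eq_zero {u u' v w : V} {p p' : List E} (hp : G.IsPath u p v)
    (hp' : G.IsPath u' p' w) (hl : p.length ≤ p'.length)
    (h : ∀ q, p' = p ++ q → ¬ G.IsPath v q w) : ghost K G p v * real K G p' w = 0 := by
  induction p generalizing u u' p' with
  | nil =>
    refine vx_mul_real_of_ne hp' ?_
    rintro rfl
    exact h p' rfl hp'
  | cons e p ih =>
    cases p' with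
    | nil => simp at hl
    | cons f p' =>
      rw [ghost_cons, real_cons, mul_assoc, ← mul_assoc (gh K G e)]
      by_cases hef : e = f
      · subst hef
        rw [gh_mul_ed, vx_mul_real hp'.2]
        exact ih hp.2 hp'.2 (by simpa using hl) fun q hq => h q (by rw [hq]; rfl)
      · rw [gh_mul_ed_of_ne hef, zero_mul, mul_zero]

open Classical in
/-- Left multiplication by a ghost path strips that path from all real paths. -/
theorem ghost_mul_comb {u v w : V} {p : List E} (hp : G.IsPath u p v) {c : List E →₀ K}
    (hc : ∀ p' ∈ c.support, (∃ u', G.IsPath u' p' w) ∧ p.length ≤ p'.length) :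
    ghost K G p v * comb K G w c =
      comb K G w ((c.comapDomain (p ++ ·) (List.append_right_injective p).injOn).filter
        (G.IsPath v · w)) := by
  rw [comb_apply, comb_apply, Finset.mul_sum]
  symm
  refine Finset.sum_of_injOn (p ++ ·) (List.append_right_injective p).injOn ?_ ?_ ?_
  · intro q hq
    simp only [Finset.mem_coe, Finsupp.mem_support_iff, Finsupp.filter_apply,
      Finsupp.comapDomain_apply, ne_eq, ite_eq_right_iff, Classical.not_imp] at hq ⊢
    exact hq.2
  · intro p' hp' hn
    obtain ⟨⟨u', hu'⟩, hl⟩ := hc p' hp'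
    rw [mul_smul_comm, ghost_mul_real_eq_zero hp hu' hl, smul_zero]
    rintro q rfl hq
    refine hn ⟨q, ?_, rfl⟩
    simp only [Finset.mem_coe, Finsupp.mem_support_iff, Finsupp.filter_apply,
      Finsupp.comapDomain_apply, ne_eq, ite_eq_right_iff, Classical.not_imp]
    exact ⟨hq, Finsupp.mem_support_iff.mp hp'⟩
  · intro q hq
    simp only [Finsupp.mem_support_iff, Finsupp.filter_apply,
      Finsupp.comapDomain_apply, ne_eq, ite_eq_right_iff, Classical.not_imp] at hq
    rw [Finsupp.filter_apply, if_pos hq.1, mul_smul_comm, ghost_mul_real_append hp hq.1,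
      Finsupp.comapDomain_apply]

theorem comb_mul_real {v w : V} {q : List E} (h : G.IsPath v q w) (c : List E →₀ K) :
    comb K G v c * real K G q w = comb K G w (c.mapDomain (· ++ q)) := by
  rw [comb, comb, Finsupp.linearCombination_mapDomain, Finsupp.linearCombination_apply,
    Finsupp.linearCombination_apply, Finsupp.sum, Finsupp.sum, Finset.sum_mul]
  refine Finset.sum_congr rfl fun p _ => ?_
  rw [smul_mul_assoc, real_mul_real p h]
  rfl

theorem comb_mul_vx (v : V) (c : List E →₀ K) : comb K G v c * vx K G v = comb K G v c := by
  rw [comb_apply, Finset.sum_mul]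
  simp only [smul_mul_assoc, real_mul_vx]

/-- The linear combinations of paths with range `w`, with honest paths only and not formally
zero. -/
def IsPathComb (G : DirGraph V E) (w : V) (c : List E →₀ K) : Prop :=
  c ≠ 0 ∧ ∀ p ∈ c.support, ∃ u, G.IsPath u p w

/-- The coefficients of an element with nonzero scalar part and otherwise closed paths at `w`. -/
def IsClosedComb (G : DirGraph V E) (w : V) (c : List E →₀ K) : Prop :=
  c [] ≠ 0 ∧ ∀ p ∈ c.support, G.IsPath w p w

/-- Appending q is injective on lists, so no coefficients cancel. -/
theorem IsPathComb.mul_real {v w : V} {c : List E →₀ K} (hc : IsPathComb G v c) {q : List E}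
    (h : G.IsPath v q w) : IsPathComb G w (c.mapDomain (· ++ q)) := by
  classical
  refine ⟨fun h0 => hc.1 ?_, fun p hp => ?_⟩
  · exact Finsupp.mapDomain_injective (List.append_left_injective q) (by simpa using h0)
  · obtain ⟨p', hp', rfl⟩ := Finset.mem_image.mp (Finsupp.mapDomain_support hp)
    obtain ⟨u, hu⟩ := hc.2 p' hp'
    exact ⟨u, hu.append h⟩

/-- Take p of minimal length in the support and multiply by p*. Paths that do not begin with p die,
p itself becomes the vertex w, and what remains of the others runs from w to w. -/
theorem IsPathComb.exists_isClosedComb {w : V} {c : List E →₀ K} (hc : IsPathComb G w c) :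
    ∃ a c', a * comb K G w c = comb K G w c' ∧ IsClosedComb G w c' := by
  classical
  obtain ⟨p, hp, hmin⟩ := Finset.exists_min_image c.support List.length
    (Finsupp.support_nonempty_iff.mpr hc.1)
  obtain ⟨u, hu⟩ := hc.2 p hp
  refine ⟨_, _, ghost_mul_comb hu fun p' hp' => ⟨hc.2 p' hp', hmin p' hp'⟩, ?_, ?_⟩
  · rw [Finsupp.filter_apply, if_pos (show G.IsPath w [] w from rfl), Finsupp.comapDomain_apply,
      List.append_nil]
    exact Finsupp.mem_support_iff.mp hp
  · intro q hq
    rw [Finsupp.mem_support_iff, Finsupp.filter_apply] at hq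
    by_contra h
    exact hq (if_neg h)

/-- A bifurcation in the tree of `v` allows to remove a closed path by conjugation. -/
theorem IsClosedComb.exists_card_lt {v : V} {c : List E →₀ K} (hc : IsClosedComb G v c)
    {q : List E} (hq : q ∈ c.support) (hq₀ : q ≠ []) {x : V} (hx : x ∈ G.tree v)
    (hb : G.IsBifurcation x) :
    ∃ a b w c', a * comb K G v c * b = comb K G w c' ∧ IsClosedComb G w c' ∧
      c'.support.card < c.support.card := by
  classical
  obtain ⟨p, hp⟩ := hx
  obtain ⟨e, he, f, hf, hef⟩ := hb
  -- Try ν = pe and ν = pf. If qν begins with ν, the letter of qν at position |p| is the last edge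
  -- of ν; but q is nonempty, so this letter lies in qp and does not depend on that edge. Hence e
  -- and f cannot both fail.
  have key : ∃ ν w, G.IsPath v ν w ∧ ∀ ν', q ++ ν ≠ ν ++ ν' := by
    by_contra! hcon
    have path : ∀ g, G.s g = x → G.IsPath v (p ++ [g]) (G.r g) :=
      fun g hg => hp.append ⟨hg, rfl⟩
    obtain ⟨ν₁, h₁⟩ := hcon _ _ (path e he)
    obtain ⟨ν₂, h₂⟩ := hcon _ _ (path f hf)
    have hqpos : 0 < q.length := List.length_pos_iff.mpr hq₀
    have g₁ := congrArg (fun l => l[p.length]?) h₁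
    have g₂ := congrArg (fun l => l[p.length]?) h₂
    have hlen : ∀ g : E, (q ++ (p ++ [g]))[p.length]? = (q ++ p)[p.length]? := by
      intro g
      rw [← List.append_assoc, List.getElem?_append_left]
      simp; omega
    simp only [hlen] at g₁ g₂
    rw [g₁] at g₂
    simp at g₂
    exact hef g₂
  obtain ⟨ν, w, hν, hne⟩ := key
  have hsupp : ∀ p' ∈ (c.mapDomain (· ++ ν)).support, ∃ p ∈ c.support, p ++ ν = p' := fun p' hp' =>
    Finset.mem_image.mp (Finsupp.mapDomain_support hp')
  have hval : ∀ p, (c.mapDomain (· ++ ν)) (p ++ ν) = c p := fun p =>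
    Finsupp.mapDomain_apply (List.append_left_injective ν) c p
  have hmul := ghost_mul_comb hν (w := w) (c := c.mapDomain (· ++ ν)) fun p' hp' => by
    obtain ⟨p, hp, rfl⟩ := hsupp p' hp'
    exact ⟨⟨v, (hc.2 p hp).append hν⟩, by simp⟩
  rw [← comb_mul_real hν, ← mul_assoc] at hmul
  refine ⟨ghost K G ν w, real K G ν w, w, _, hmul, ⟨?_, ?_⟩, ?_⟩
  · rw [Finsupp.filter_apply, if_pos (show G.IsPath w [] w from rfl), Finsupp.comapDomain_apply,
      List.append_nil]
    have := hval []
    rw [List.nil_append] at this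
    rw [this]
    exact hc.1
  · intro q hq
    rw [Finsupp.mem_support_iff, Finsupp.filter_apply] at hq
    by_contra h
    exact hq (if_neg h)
  -- A surviving ν' satisfies νν' = pν for some p in the old support, and p ≠ q by the choice of ν.
  -- Both concatenations with ν are injective, so the new support is no larger than the old one
  -- without q.
  · rw [← Finset.card_erase_add_one hq, Nat.lt_succ_iff,
      ← Finset.card_image_of_injective _ (List.append_right_injective ν),
      ← Finset.card_image_of_injective (c.support.erase q) (List.append_left_injective ν)]
    refine Finset.card_le_card fun p' hp' => ?_
    obtain ⟨ν', hν', rfl⟩ := Finset.mem_image.mp hp'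
    rw [Finsupp.mem_support_iff, Finsupp.filter_apply, Finsupp.comapDomain_apply, ne_eq,
      ite_eq_right_iff, Classical.not_imp, ← ne_eq, ← Finsupp.mem_support_iff] at hν'
    obtain ⟨p, hp, hpν⟩ := hsupp _ hν'.2
    refine Finset.mem_image.mpr ⟨p, Finset.mem_erase.mpr ⟨?_, hp⟩, hpν⟩
    rintro rfl
    exact hne _ hpν

theorem IsClosedComb.eq_single {w : V} {c : List E →₀ K} (hc : IsClosedComb G w c)
    (h : ∀ p ∈ c.support, p = []) : ∃ k : K, k ≠ 0 ∧ c = Finsupp.single [] k := by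
  classical
  refine ⟨c [], hc.1, ?_⟩
  ext p
  rw [Finsupp.single_apply]
  split_ifs with hp
  · rw [hp]
  · exact Finsupp.notMem_support_iff.mp fun hp' => hp (h p hp').symm

/-- A combination of closed paths can be moved to a multiple of a vertex or to a vertex whose tree
has no bifurcation. -/
theorem IsClosedComb.exists_reduced {v : V} {c : List E →₀ K} (hc : IsClosedComb G v c) :
    ∃ a b w c', a * comb K G v c * b = comb K G w c' ∧ IsClosedComb G w c' ∧
      ((∀ x ∈ G.tree w, ¬ G.IsBifurcation x) ∨ ∃ k : K, k ≠ 0 ∧ c' = Finsupp.single [] k) := by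
  induction hn : c.support.card using Nat.strong_induction_on generalizing v c with
  | _ n ih =>
    have self : vx K G v * comb K G v c * vx K G v = comb K G v c := by
      rw [mul_assoc, comb_mul_vx, comb_apply, Finset.mul_sum]
      refine Finset.sum_congr rfl fun p hp => ?_
      rw [mul_smul_comm, vx_mul_real (hc.2 p hp)]
    by_cases hb : ∀ x ∈ G.tree v, ¬ G.IsBifurcation x
    · exact ⟨_, _, v, c, self, hc, .inl hb⟩
    push Not at hb
    obtain ⟨x, hx, hb⟩ := hb
    by_cases hq : ∃ q ∈ c.support, q ≠ []
    · obtain ⟨q, hq, hq₀⟩ := hq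
      obtain ⟨a, b, w, c', h, hc', hlt⟩ := hc.exists_card_lt hq hq₀ hx hb
      obtain ⟨a', b', w', c'', h', hc'', hr⟩ := ih _ (hn ▸ hlt) hc' rfl
      refine ⟨a' * a, b * b', w', c'', ?_, hc'', hr⟩
      rw [← h', ← h]
      simp only [mul_assoc]
    · push Not at hq
      exact ⟨_, _, v, c, self, hc, .inr (hc.eq_single hq)⟩

end LeavittPathAlgebra

end

/-! ### The ghost filtration and the removal of ghost edges. -/

noncomputable section

namespace LeavittPathAlgebra

variable (K : Type*) [Field K] {V E : Type*} (G : DirGraph V E)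

/-- The filtration of the Leavitt path algebra by the length of the ghost paths. -/
def ghostFiltration : ℕ → Submodule K (LeavittPathAlgebra K G)
  | 0 => Submodule.span K {x | ∃ u p w, G.IsPath u p w ∧ x = real K G p w}
  | n + 1 => ghostFiltration 0 ⊔ (Finsupp.submodule fun _ : E => ghostFiltration n).map
      (Finsupp.lsum ℕ fun e => LinearMap.mulRight K (gh K G e))

variable {K G}

theorem real_mem_ghostFiltration {u w : V} {p : List E} (h : G.IsPath u p w) :
    real K G p w ∈ ghostFiltration K G 0 := by
  rw [ghostFiltration]
  exact Submodule.subset_span ⟨u, p, w, h, rfl⟩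

theorem mem_ghostFiltration_succ {n : ℕ} {x : LeavittPathAlgebra K G} :
    x ∈ ghostFiltration K G (n + 1) ↔ ∃ y ∈ ghostFiltration K G 0, ∃ F : E →₀ LeavittPathAlgebra K G,
      (∀ e, F e ∈ ghostFiltration K G n) ∧ x = y + ∑ e ∈ F.support, F e * gh K G e := by
  rw [ghostFiltration.eq_2, Submodule.mem_sup]
  constructor
  · rintro ⟨y, hy, z, ⟨F, hF, rfl⟩, rfl⟩
    exact ⟨y, hy, F, hF, rfl⟩
  · rintro ⟨y, hy, F, hF, rfl⟩
    exact ⟨y, hy, _, ⟨F, hF, rfl⟩, rfl⟩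

theorem ghostFiltration_zero_le (n : ℕ) : ghostFiltration K G 0 ≤ ghostFiltration K G n := by
  cases n with
  | zero => exact le_rfl
  | succ n => rw [ghostFiltration.eq_2]; exact le_sup_left

theorem ghostFiltration_le_succ (n : ℕ) : ghostFiltration K G n ≤ ghostFiltration K G (n + 1) := by
  induction n with
  | zero => exact ghostFiltration_zero_le 1
  | succ n ih =>
    intro x hx
    obtain ⟨y, hy, F, hF, rfl⟩ := mem_ghostFiltration_succ.mp hx
    exact mem_ghostFiltration_succ.mpr ⟨y, hy, F, fun e => ih (hF e), rfl⟩

theorem ghostFiltration_mono : Monotone (ghostFiltration K G) :=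
  monotone_nat_of_le_succ ghostFiltration_le_succ

theorem mul_gh_mem {n : ℕ} {x : LeavittPathAlgebra K G} (hx : x ∈ ghostFiltration K G n) (e : E) :
    x * gh K G e ∈ ghostFiltration K G (n + 1) := by
  classical
  rw [ghostFiltration]
  refine Submodule.mem_sup_right ⟨Finsupp.single e x, fun f => ?_, ?_⟩
  · rw [Finsupp.single_apply]
    split_ifs
    · exact hx
    · exact Submodule.zero_mem _
  · simp

theorem mul_vx_mem {n : ℕ} {x : LeavittPathAlgebra K G} (hx : x ∈ ghostFiltration K G n) (v : V) :
    x * vx K G v ∈ ghostFiltration K G n := by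
  have zero : ∀ y ∈ ghostFiltration K G 0, y * vx K G v ∈ ghostFiltration K G 0 := by
    intro y hy
    rw [ghostFiltration] at hy
    induction hy using Submodule.span_induction with
    | mem y hy =>
      obtain ⟨u, p, w, h, rfl⟩ := hy
      by_cases hw : w = v
      · rw [← hw, real_mul_vx]
        exact real_mem_ghostFiltration h
      · rw [real_mul_vx_of_ne p hw]
        exact Submodule.zero_mem _
    | zero => rw [zero_mul]; exact Submodule.zero_mem _
    | add y z _ _ hy hz => rw [add_mul]; exact Submodule.add_mem _ hy hz
    | smul c y _ hy => rw [smul_mul_assoc]; exact Submodule.smul_mem _ c hy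
  cases n with
  | zero => exact zero x hx
  | succ n =>
    obtain ⟨y, hy, F, hF, rfl⟩ := mem_ghostFiltration_succ.mp hx
    rw [add_mul, Finset.sum_mul]
    refine Submodule.add_mem _ (ghostFiltration_zero_le _ (zero y hy))
      (Submodule.sum_mem _ fun e _ => ?_)
    rw [mul_assoc]
    by_cases hv : G.s e = v
    · rw [← hv, gh_mul_vx]
      exact mul_gh_mem (hF e) e
    · rw [gh_mul_vx_of_ne hv, mul_zero]
      exact Submodule.zero_mem _

theorem mul_ed_mem_zero {x : LeavittPathAlgebra K G} (hx : x ∈ ghostFiltration K G 0) (e : E) :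
    x * ed K G e ∈ ghostFiltration K G 0 := by
  rw [ghostFiltration] at hx
  induction hx using Submodule.span_induction with
  | mem y hy =>
    obtain ⟨u, p, w, h, rfl⟩ := hy
    have he : ed K G e = real K G [e] (G.r e) := by simp
    by_cases hw : w = G.s e
    · have hpe : G.IsPath w [e] (G.r e) := ⟨hw.symm, rfl⟩
      rw [he, real_mul_real p hpe]
      exact real_mem_ghostFiltration (h.append hpe)
    · rw [← real_mul_vx, mul_assoc, vx_mul_ed_of_ne hw, mul_zero]
      exact Submodule.zero_mem _
  | zero => rw [zero_mul]; exact Submodule.zero_mem _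
  | add y z _ _ hy hz => rw [add_mul]; exact Submodule.add_mem _ hy hz
  | smul c y _ hy => rw [smul_mul_assoc]; exact Submodule.smul_mem _ c hy

theorem sum_gh_mul_ed (F : E →₀ LeavittPathAlgebra K G) (e : E) :
    (∑ f ∈ F.support, F f * gh K G f) * ed K G e = F e * vx K G (G.r e) := by
  rw [Finset.sum_mul, Finset.sum_eq_single e]
  · rw [mul_assoc, gh_mul_ed]
  · intro f _ hf
    rw [mul_assoc, gh_mul_ed_of_ne hf, mul_zero]
  · intro he
    rw [Finsupp.notMem_support_iff.mp he, zero_mul, zero_mul]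

/-- A real edge on the right cancels the last ghost edge, which lowers the filtration degree; this
drives the induction in `exists_comb_of_mem`. -/
theorem mul_ed_mem_of_succ {n : ℕ} {x : LeavittPathAlgebra K G}
    (hx : x ∈ ghostFiltration K G (n + 1)) (e : E) : x * ed K G e ∈ ghostFiltration K G n := by
  obtain ⟨y, hy, F, hF, rfl⟩ := mem_ghostFiltration_succ.mp hx
  rw [add_mul, sum_gh_mul_ed]
  exact Submodule.add_mem _ (ghostFiltration_zero_le _ (mul_ed_mem_zero hy e))
    (mul_vx_mem (hF e) _)

theorem exists_mem_ghostFiltration (x : LeavittPathAlgebra K G) :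
    ∃ n, x ∈ ghostFiltration K G n := by
  have mem : ∀ y, y ∈ ⨆ n, ghostFiltration K G n ↔ ∃ n, y ∈ ghostFiltration K G n := fun y =>
    Submodule.mem_iSup_of_directed _ ghostFiltration_mono.directed_le
  rw [← mem]
  refine mem_of_gen_mem _ ?_ ?_ ?_ ?_ ?_ ?_ x
  · exact fun v => (mem _).mpr ⟨0, real_mem_ghostFiltration (p := []) rfl⟩
  · intro e
    have := real_mem_ghostFiltration (K := K) (G := G) (u := G.s e) (p := [e]) ⟨rfl, rfl⟩
    rw [real_cons, real_nil, ed_mul_vx] at this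
    exact (mem _).mpr ⟨0, this⟩
  · intro e
    have := mul_gh_mem (real_mem_ghostFiltration (K := K) (G := G) (u := G.r e) (p := []) rfl) e
    rw [real_nil, vx_mul_gh] at this
    exact (mem _).mpr ⟨1, this⟩
  · intro y hy v
    obtain ⟨n, hn⟩ := (mem _).mp hy
    exact (mem _).mpr ⟨n, mul_vx_mem hn v⟩
  · intro y hy e
    obtain ⟨n, hn⟩ := (mem _).mp hy
    exact (mem _).mpr ⟨n, mul_ed_mem_of_succ (ghostFiltration_le_succ n hn) e⟩
  · intro y hy e
    obtain ⟨n, hn⟩ := (mem _).mp hy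
    exact (mem _).mpr ⟨n + 1, mul_gh_mem hn e⟩

/-- The Leavitt path algebra has local units on the right. -/
theorem exists_mul_vx_ne_zero {x : LeavittPathAlgebra K G} (hx : x ≠ 0) :
    ∃ v, x * vx K G v ≠ 0 := by
  classical
  -- Quantifying over all larger sets t' makes the property stable under sums, by taking unions.
  have key : ∃ t : Finset V, ∀ t', t ⊆ t' → x = ∑ v ∈ t', x * vx K G v := by
    have single : ∀ (y : LeavittPathAlgebra K G) (w : V), y * vx K G w = y →
        ∃ t : Finset V, ∀ t', t ⊆ t' → y = ∑ v ∈ t', y * vx K G v := by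
      intro y w hw
      refine ⟨{w}, fun t' ht => ?_⟩
      rw [Finset.sum_eq_single w, hw]
      · intro v _ hv
        rw [← hw, mul_assoc, vx_mul_of_ne hv.symm, mul_zero]
      · exact fun h => absurd (ht (Finset.mem_singleton_self w)) h
    let D : Submodule K (LeavittPathAlgebra K G) :=
      { carrier := {y | ∃ t : Finset V, ∀ t', t ⊆ t' → y = ∑ v ∈ t', y * vx K G v}
        zero_mem' := ⟨∅, by simp⟩
        add_mem' := by
          rintro y z ⟨t₁, h₁⟩ ⟨t₂, h₂⟩
          refine ⟨t₁ ∪ t₂, fun t' ht => ?_⟩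
          simp only [add_mul]
          rw [Finset.sum_add_distrib, ← h₁ t' (Finset.union_subset_left ht),
            ← h₂ t' (Finset.union_subset_right ht)]
        smul_mem' := by
          rintro c y ⟨t, h⟩
          refine ⟨t, fun t' ht => ?_⟩
          simp only [smul_mul_assoc]
          rw [← Finset.smul_sum, ← h t' ht] }
    refine mem_of_gen_mem D ?_ ?_ ?_ ?_ ?_ ?_ x
    · exact fun v => single _ v (vx_mul_self v)
    · exact fun e => single _ _ (ed_mul_vx e)
    · exact fun e => single _ _ (gh_mul_vx e)
    · exact fun y _ v => single _ v (by rw [mul_assoc, vx_mul_self])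
    · exact fun y _ e => single _ (G.r e) (by rw [mul_assoc, ed_mul_vx])
    · exact fun y _ e => single _ (G.s e) (by rw [mul_assoc, gh_mul_vx])
  by_contra! h
  obtain ⟨t, ht⟩ := key
  exact hx ((ht t subset_rfl).trans (by simp [h]))

theorem exists_comb {y : LeavittPathAlgebra K G} (hy : y ∈ ghostFiltration K G 0) (v : V) :
    ∃ c : List E →₀ K, (∀ p ∈ c.support, ∃ u, G.IsPath u p v) ∧ y * vx K G v = comb K G v c := by
  classical
  rw [ghostFiltration] at hy
  induction hy using Submodule.span_induction with
  | mem y hy =>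
    obtain ⟨u, p, w, h, rfl⟩ := hy
    by_cases hw : w = v
    · subst hw
      refine ⟨Finsupp.single p 1, fun q hq => ?_, by simp [comb]⟩
      have := Finsupp.support_single_subset hq
      rw [Finset.mem_singleton.mp this]
      exact ⟨u, h⟩
    · exact ⟨0, by simp, by simp [real_mul_vx_of_ne p hw]⟩
  | zero => exact ⟨0, by simp, by simp⟩
  | add y z _ _ hy hz =>
    obtain ⟨c, hc, h⟩ := hy
    obtain ⟨d, hd, h'⟩ := hz
    refine ⟨c + d, fun p hp => ?_, by rw [add_mul, h, h', map_add]⟩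
    exact (Finset.mem_union.mp (Finsupp.support_add hp)).elim (hc p) (hd p)
  | smul k y _ hy =>
    obtain ⟨c, hc, h⟩ := hy
    exact ⟨k • c, fun p hp => hc p (Finsupp.support_smul hp), by rw [smul_mul_assoc, h, map_smul]⟩

/-- If xe ≠ 0 for some edge e at v, then xe has lower degree. If all xe vanish, v is not regular,
since otherwise x = Σ xee* = 0; so v is a sink or an infinite emitter. -/
theorem exists_comb_of_mem {n : ℕ} {v : V} {x : LeavittPathAlgebra K G}
    (hx : x ∈ ghostFiltration K G n) (hv : x * vx K G v = x) (h₀ : x ≠ 0) :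
    ∃ p w c, G.IsPath v p w ∧ IsPathComb G w c ∧ x * real K G p w = comb K G w c := by
  induction n generalizing v x with
  | zero =>
    obtain ⟨c, hc, h⟩ := exists_comb hx v
    refine ⟨[], v, c, rfl, ⟨?_, hc⟩, h⟩
    rintro rfl
    exact h₀ (hv.symm.trans (h.trans (map_zero _)))
  | succ n ih =>
    by_cases he : ∃ e, G.s e = v ∧ x * ed K G e ≠ 0
    · obtain ⟨e, hs, he⟩ := he
      obtain ⟨p, w, c, hp, hc, h⟩ := ih (v := G.r e) (mul_ed_mem_of_succ hx e)
        (by rw [mul_assoc, ed_mul_vx]) he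
      refine ⟨e :: p, w, c, ⟨hs, hp⟩, hc, ?_⟩
      rw [real_cons, ← mul_assoc, h]
    push Not at he
    have hreg : ¬ G.IsRegular v := by
      intro hr
      apply h₀
      rw [← hv, vx_eq_sum hr, Finset.mul_sum]
      refine Finset.sum_eq_zero fun e hes => ?_
      rw [← mul_assoc, he e (by simpa using hes), zero_mul]
    obtain ⟨y, hy, F, -, hxy⟩ := mem_ghostFiltration_succ.mp hx
    obtain ⟨c, hc, hyc⟩ := exists_comb hy v
    have hFe : ∀ e, G.s e = v → F e * vx K G (G.r e) = -(y * ed K G e) := by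
      intro e hs
      have := he e hs
      rw [hxy, add_mul, sum_gh_mul_ed, add_comm] at this
      exact eq_neg_of_add_eq_zero_left this
    -- The equations xe = 0 express the ghost part through the real part, so x is the combination c
    -- times (v - Σ ee*) over finitely many e.
    have hxc : x = comb K G v c -
        ∑ e ∈ F.support, comb K G v c * (ed K G e * gh K G e) * vx K G v := by
      rw [← hv, hxy, add_mul, hyc, Finset.sum_mul, sub_eq_add_neg, ← Finset.sum_neg_distrib]
      congr 1
      refine Finset.sum_congr rfl fun e _ => ?_
      by_cases hs : G.s e = v
      · have : comb K G v c * ed K G e = y * ed K G e := by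
          rw [← hyc, ← hs, mul_assoc, vx_mul_ed]
        rw [← mul_assoc (comb K G v c), this, ← neg_mul, ← neg_mul, ← hFe e hs,
          mul_assoc (F e) (vx K G (G.r e)), vx_mul_gh]
      · rw [mul_assoc, mul_assoc, mul_assoc, gh_mul_vx_of_ne hs]
        simp
    have hc₀ : c ≠ 0 := by
      rintro rfl
      exact h₀ (by rw [hxc]; simp)
    by_cases hsink : G.IsSink v
    · refine ⟨[], v, c, rfl, ⟨hc₀, hc⟩, ?_⟩
      rw [real_nil, hv, hxc, sub_eq_self]
      refine Finset.sum_eq_zero fun e _ => ?_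
      have hs : G.s e ≠ v := fun hs => by
        have : e ∈ G.s ⁻¹' {v} := hs
        rw [hsink] at this
        exact this
      rw [mul_assoc, mul_assoc, gh_mul_vx_of_ne hs, mul_zero, mul_zero]
    · have hinf : (G.s ⁻¹' {v}).Infinite := by
        by_contra h
        exact hreg ⟨hsink, h⟩
      -- An edge f at v outside the finite sum kills every ee* in it and leaves the combination of
      -- the paths pf.
      obtain ⟨f, hf, hfF⟩ := hinf.exists_notMem_finset F.support
      have hpf : G.IsPath v [f] (G.r f) := ⟨hf, rfl⟩
      refine ⟨[f], G.r f, _, hpf, IsPathComb.mul_real ⟨hc₀, hc⟩ hpf, ?_⟩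
      rw [← comb_mul_real hpf]
      nth_rewrite 1 [hxc]
      rw [sub_mul, sub_eq_self, Finset.sum_mul]
      refine Finset.sum_eq_zero fun e heF => ?_
      have hef : e ≠ f := fun h => hfF (h ▸ heF)
      rw [mul_assoc, vx_mul_real hpf, real_cons, mul_assoc, mul_assoc, ← mul_assoc (gh K G e),
        gh_mul_ed_of_ne hef]
      simp

/-- Every nonzero element can be moved to a combination of real paths. -/
theorem exists_mul_real_eq_comb {v : V} {x : LeavittPathAlgebra K G}
    (hv : x * vx K G v = x) (h₀ : x ≠ 0) :
    ∃ p w c, G.IsPath v p w ∧ IsPathComb G w c ∧ x * real K G p w = comb K G w c :=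
  have ⟨_, hn⟩ := exists_mem_ghostFiltration x
  exists_comb_of_mem hn hv h₀

/-- Reduction: every nonzero element can be moved to a nonzero multiple of a vertex, or to a vertex
whose tree has no bifurcation. -/
theorem exists_reduced {x : LeavittPathAlgebra K G} (h₀ : x ≠ 0) :
    ∃ a b w c, a * x * b = comb K G w c ∧ IsClosedComb G w c ∧
      ((∀ x ∈ G.tree w, ¬ G.IsBifurcation x) ∨ ∃ k : K, k ≠ 0 ∧ c = Finsupp.single [] k) := by
  obtain ⟨v, hv⟩ := exists_mul_vx_ne_zero h₀
  obtain ⟨p, w, c, -, hc, h⟩ := exists_mul_real_eq_comb (by rw [mul_assoc, vx_mul_self]) hv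
  obtain ⟨a, c', h', hc'⟩ := hc.exists_isClosedComb
  obtain ⟨a', b', w', c'', h'', hc'', hr⟩ := hc'.exists_reduced
  refine ⟨a' * a, vx K G v * real K G p w * b', w', c'', ?_, hc'', hr⟩
  rw [← h'', ← h', ← h]
  simp only [mul_assoc]

end LeavittPathAlgebra

end

/-! ### A branching representation over Laurent polynomials. -/

namespace DirGraph

variable {V E : Type*} (G : DirGraph V E)

/-- Every vertex which emits edges splits `E ⊕ ℕ` into copies of it indexed by these edges. -/
theorem exists_branching : ∃ φ : E → E ⊕ ℕ → E ⊕ ℕ,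
    (∀ e f s t, G.s e = G.s f → φ e s = φ f t → e = f ∧ s = t) ∧
    (∀ e t, ∃ f s, G.s f = G.s e ∧ φ f s = t) ∧
    (∀ e, ¬ G.IsBifurcation (G.s e) → φ e = id) := by
  have loc : ∀ v, ∃ ψ : {e // G.s e = v} × (E ⊕ ℕ) → E ⊕ ℕ, Function.Injective ψ ∧
      (Nonempty {e // G.s e = v} → Function.Surjective ψ) ∧
      (¬ G.IsBifurcation v → ∀ x, ψ x = x.2) := by
    intro v
    by_cases hb : G.IsBifurcation v
    -- The label set E ⊕ ℕ is infinite and at least as large as E, so its product with any nonempty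
    -- set of edges is equipotent to it.
    · obtain ⟨e, he, -⟩ := hb.nonempty.imp fun e he => And.intro he trivial
      have hinf : Cardinal.aleph0 ≤ Cardinal.mk (E ⊕ ℕ) := Cardinal.aleph0_le_mk _
      have hle : Cardinal.mk {e // G.s e = v} ≤ Cardinal.mk (E ⊕ ℕ) :=
        Cardinal.mk_le_of_injective (f := fun e => Sum.inl e.1)
          (Sum.inl_injective.comp Subtype.val_injective)
      have hne : Cardinal.mk {e // G.s e = v} ≠ 0 :=
        Cardinal.mk_ne_zero_iff.mpr ⟨⟨e, he⟩⟩
      obtain ⟨ψ⟩ : Nonempty ({e // G.s e = v} × (E ⊕ ℕ) ≃ E ⊕ ℕ) := by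
        rw [← Cardinal.eq, ← Cardinal.mul_def, Cardinal.mul_eq_right hinf hle hne]
      exact ⟨ψ, ψ.injective, fun _ => ψ.surjective, fun h => absurd hb h⟩
    · refine ⟨Prod.snd, ?_, ?_, fun _ _ => rfl⟩
      · rintro ⟨⟨e, he⟩, s⟩ ⟨⟨f, hf⟩, t⟩ (rfl : s = t)
        cases eq_of_not_isBifurcation hb he hf
        rfl
      · rintro ⟨e⟩ s
        exact ⟨(e, s), rfl⟩
  choose ψ inj surj triv using loc
  have trans : ∀ e v (h : G.s e = v) (s : E ⊕ ℕ),
      ψ (G.s e) (⟨e, rfl⟩, s) = ψ v (⟨e, h⟩, s) := by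
    rintro e _ rfl s
    rfl
  refine ⟨fun e s => ψ (G.s e) (⟨e, rfl⟩, s), ?_, ?_, ?_⟩
  · intro e f s t hef h
    beta_reduce at h
    rw [trans e _ hef, trans f _ rfl] at h
    simpa using inj _ h
  · intro e t
    obtain ⟨⟨⟨f, hf⟩, s⟩, h⟩ := surj (G.s e) ⟨⟨e, rfl⟩⟩ t
    exact ⟨f, s, hf, (trans f _ hf s).trans h⟩
  · intro e he
    funext s
    exact triv _ he _

end DirGraph

noncomputable section

namespace LeavittPathAlgebra

open scoped LaurentPolynomial
open Classical

variable (K : Type*) [Field K] {V E : Type*} (G : DirGraph V E)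

/-- The action of the generators on the free `K[T;T⁻¹]`-module on `V × S` that is attached to a
branching `φ`: real edges prolong by `φ` and scale by `T`. -/
def genAction {S : Type*} (φ : E → S → S) :
    LeavittGen V E → Module.End K[T;T⁻¹] (V × S →₀ K[T;T⁻¹])
  | .vertex v => Finsupp.linearCombination _ fun x => if x.1 = v then Finsupp.single x 1 else 0
  | .edge e => Finsupp.linearCombination _ fun x =>
      if x.1 = G.r e then Finsupp.single (G.s e, φ e x.2) (LaurentPolynomial.T 1) else 0
  | .ghost e => Finsupp.linearCombination _ fun x =>
      if h : x.1 = G.s e ∧ ∃ s, φ e s = x.2 then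
        Finsupp.single (G.r e, h.2.choose) (LaurentPolynomial.T (-1)) else 0

variable {K G}

section

variable {S : Type*} {φ : E → S → S}

theorem genAction_vertex (v : V) (s : S) (a : K[T;T⁻¹]) :
    genAction K G φ (.vertex v) (Finsupp.single (v, s) a) = Finsupp.single (v, s) a := by
  simp [genAction]

theorem genAction_vertex_of_ne {v u : V} (h : u ≠ v) (s : S) (a : K[T;T⁻¹]) :
    genAction K G φ (.vertex v) (Finsupp.single (u, s) a) = 0 := by
  simp [genAction, h]

theorem genAction_edge (e : E) (s : S) (a : K[T;T⁻¹]) :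
    genAction K G φ (.edge e) (Finsupp.single (G.r e, s) a) =
      Finsupp.single (G.s e, φ e s) (a * LaurentPolynomial.T 1) := by
  simp [genAction]

theorem genAction_edge_of_ne {e : E} {u : V} (h : u ≠ G.r e) (s : S) (a : K[T;T⁻¹]) :
    genAction K G φ (.edge e) (Finsupp.single (u, s) a) = 0 := by
  simp [genAction, h]

theorem genAction_ghost {e : E} (hφ : Function.Injective (φ e)) (s : S) (a : K[T;T⁻¹]) :
    genAction K G φ (.ghost e) (Finsupp.single (G.s e, φ e s) a) =
      Finsupp.single (G.r e, s) (a * LaurentPolynomial.T (-1)) := by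
  have h : ∃ t, φ e t = φ e s := ⟨s, rfl⟩
  have hc : h.choose = s := hφ h.choose_spec
  simp only [genAction, Finsupp.linearCombination_single]
  rw [dif_pos (And.intro trivial h), hc, Finsupp.smul_single, smul_eq_mul]

theorem genAction_ghost_of_not {e : E} {u : V} {s : S} (h : ¬ (u = G.s e ∧ ∃ t, φ e t = s))
    (a : K[T;T⁻¹]) : genAction K G φ (.ghost e) (Finsupp.single (u, s) a) = 0 := by
  simp only [genAction, Finsupp.linearCombination_single]
  rw [dif_neg h, smul_zero]

/-- Injectivity gives e*f = δ; joint surjectivity makes Σ ee* act as the identity at a regular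
vertex. -/
theorem genAction_rel (inj : ∀ e f s t, G.s e = G.s f → φ e s = φ f t → e = f ∧ s = t)
    (surj : ∀ e t, ∃ f s, G.s f = G.s e ∧ φ f s = t)
    (x y : FreeNonUnitalAlg K (LeavittGen V E)) (h : Leavitt.Rel K G x y) :
    freeLift K (genAction K G φ) x =
      freeLift K (genAction K G φ) y := by
  have injφ : ∀ e, Function.Injective (φ e) := fun e s t h => (inj e e s t rfl h).2
  induction h with
  | smul c _ ih => rw [map_smul, map_smul, ih]
  | vertex_idem v =>
    simp only [map_mul, freeLift_gen]
    refine Finsupp.lhom_ext fun ⟨u, s⟩ a => ?_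
    rw [Module.End.mul_apply]
    by_cases h : u = v
    · subst h; simp only [genAction_vertex]
    · simp only [genAction_vertex_of_ne h, map_zero]
  | vertex_orth v w hvw =>
    simp only [map_mul, freeLift_gen, map_zero]
    refine Finsupp.lhom_ext fun ⟨u, s⟩ a => ?_
    rw [Module.End.mul_apply, LinearMap.zero_apply]
    by_cases h : u = w
    · subst h; rw [genAction_vertex, genAction_vertex_of_ne hvw.symm]
    · rw [genAction_vertex_of_ne h, map_zero]
  | source_edge e =>
    simp only [map_mul, freeLift_gen]
    refine Finsupp.lhom_ext fun ⟨u, s⟩ a => ?_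
    rw [Module.End.mul_apply]
    by_cases h : u = G.r e
    · subst h; rw [genAction_edge, genAction_vertex]
    · rw [genAction_edge_of_ne h, map_zero]
  | edge_range e =>
    simp only [map_mul, freeLift_gen]
    refine Finsupp.lhom_ext fun ⟨u, s⟩ a => ?_
    rw [Module.End.mul_apply]
    by_cases h : u = G.r e
    · subst h; rw [genAction_vertex]
    · rw [genAction_vertex_of_ne h, genAction_edge_of_ne h, map_zero]
  | range_ghost e =>
    simp only [map_mul, freeLift_gen]
    refine Finsupp.lhom_ext fun ⟨u, s⟩ a => ?_
    rw [Module.End.mul_apply]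
    by_cases h : u = G.s e ∧ ∃ t, φ e t = s
    · obtain ⟨rfl, t, rfl⟩ := h
      rw [genAction_ghost (injφ e), genAction_vertex]
    · rw [genAction_ghost_of_not h, map_zero]
  | ghost_source e =>
    simp only [map_mul, freeLift_gen]
    refine Finsupp.lhom_ext fun ⟨u, s⟩ a => ?_
    rw [Module.End.mul_apply]
    by_cases h : u = G.s e
    · subst h; rw [genAction_vertex]
    · rw [genAction_vertex_of_ne h, genAction_ghost_of_not fun h' => h h'.1, map_zero]
  | ghost_edge e =>
    simp only [map_mul, freeLift_gen]
    refine Finsupp.lhom_ext fun ⟨u, s⟩ a => ?_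
    rw [Module.End.mul_apply]
    by_cases h : u = G.r e
    · subst h
      rw [genAction_edge, genAction_ghost (injφ e), genAction_vertex, mul_assoc,
        ← LaurentPolynomial.T_add]
      simp
    · rw [genAction_edge_of_ne h, genAction_vertex_of_ne h, map_zero]
  | ghost_edge_ne e f hef =>
    simp only [map_mul, freeLift_gen, map_zero]
    refine Finsupp.lhom_ext fun ⟨u, s⟩ a => ?_
    rw [Module.End.mul_apply, LinearMap.zero_apply]
    by_cases h : u = G.r f
    · subst h
      rw [genAction_edge, genAction_ghost_of_not]
      rintro ⟨hs, t, ht⟩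
      exact hef (inj e f t s hs.symm ht).1
    · rw [genAction_edge_of_ne h, map_zero]
  | regular v hv =>
    simp only [map_sum, map_mul, freeLift_gen]
    refine Finsupp.lhom_ext fun ⟨u, s⟩ a => ?_
    rw [LinearMap.sum_apply]
    simp only [Module.End.mul_apply]
    by_cases h : u = v
    · subst h
      obtain ⟨e₀, he₀⟩ := Set.nonempty_iff_ne_empty.mpr hv.1
      obtain ⟨e, t, he, rfl⟩ := surj e₀ s
      rw [he₀] at he
      subst he
      rw [genAction_vertex, Finset.sum_eq_single e]
      · rw [genAction_ghost (injφ e), genAction_edge, mul_assoc, ← LaurentPolynomial.T_add]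
        simp
      · intro f hf hfe
        rw [genAction_ghost_of_not, map_zero]
        rintro ⟨hs, t', ht⟩
        exact hfe (inj f e t' t hs.symm ht).1
      · intro he
        simp at he
    · rw [genAction_vertex_of_ne h, Finset.sum_eq_zero]
      intro e he
      rw [genAction_ghost_of_not, map_zero]
      rintro ⟨rfl, -⟩
      exact h (by simpa using he)

end

/-- The scaled boundary representation: a vertex acts without being zero, and paths along which
there is no bifurcation act by a power of the parameter. -/
theorem exists_rep : ∃ (ρ : LeavittPathAlgebra K G →ₙ+* Module.End K[T;T⁻¹] (V × (E ⊕ ℕ) →₀ K[T;T⁻¹])),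
    (∀ (c : K) x, ρ (c • x) = c • ρ x) ∧
    (∀ u p w, G.IsPath u p w → (∀ x ∈ G.tree u, ¬ G.IsBifurcation x) → ∀ a,
      ρ (real K G p w) (Finsupp.single (w, Sum.inr 0) a) =
        Finsupp.single (u, Sum.inr 0) (a * LaurentPolynomial.T p.length)) ∧
    ∀ v a, ρ (vx K G v) (Finsupp.single (v, Sum.inr 0) a) = Finsupp.single (v, Sum.inr 0) a := by
  obtain ⟨φ, inj, surj, triv⟩ := G.exists_branching
  let ρ := lift (genAction K G φ) (genAction_rel inj surj)
  have hv : ∀ v, ρ (vx K G v) = genAction K G φ (.vertex v) := fun v => freeLift_gen _ _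
  have he : ∀ e, ρ (ed K G e) = genAction K G φ (.edge e) := fun e => freeLift_gen _ _
  refine ⟨ρ, lift_smul _ _, ?_, fun v a => ?_⟩
  · intro u p w hp hb a
    induction p generalizing u with
    | nil =>
      cases hp
      rw [real_nil, hv, genAction_vertex]
      simp
    | cons e p ih =>
      obtain ⟨rfl, hp⟩ := hp
      -- Without bifurcation `φ e` is the identity, so the label `Sum.inr 0` stays fixed and only
      -- the power of T grows.
      rw [real_cons, map_mul, Module.End.mul_apply,
        ih _ hp fun x hx => hb x (DirGraph.tree_subset (DirGraph.range_mem_tree e) hx), he,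
        genAction_edge, triv e (hb _ (DirGraph.self_mem_tree _)), mul_assoc,
        ← LaurentPolynomial.T_add]
      simp
  · rw [hv, genAction_vertex]

theorem vx_ne_zero (v : V) : vx K G v ≠ 0 := by
  obtain ⟨ρ, -, -, h⟩ := exists_rep (K := K) (G := G)
  intro h₀
  have := h v 1
  rw [h₀, map_zero, LinearMap.zero_apply, eq_comm, Finsupp.single_eq_zero] at this
  exact one_ne_zero this

/-- If the tree of `w` has no bifurcation, then a combination of closed paths at `w` with nonzero
scalar part is not a left multiple of its product with `w` minus a nontrivial closed path. -/
theorem IsClosedComb.ne_mul {w : V} {c : List E →₀ K} (hc : IsClosedComb G w c)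
    (hb : ∀ x ∈ G.tree w, ¬ G.IsBifurcation x) {q : List E} (hq₀ : q ≠ [])
    (hq : G.IsPath w q w) (y : LeavittPathAlgebra K G) :
    y * ((vx K G w - real K G q w) * comb K G w c) ≠ comb K G w c ∧
      (vx K G w - real K G q w) * comb K G w c ≠ 0 := by
  obtain ⟨ρ, hρ, hpath, hvx⟩ := exists_rep (K := K) (G := G)
  -- The scalar by which the combination acts on the basis vector at w. Its constant term is `c []`,
  -- as only the empty path has length 0.
  let P : K[T;T⁻¹] := ∑ p ∈ c.support, c p • LaurentPolynomial.T (p.length : ℤ)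
  have hP : P ≠ 0 := by
    have hpoly : P = Polynomial.toLaurent (∑ p ∈ c.support, c p • Polynomial.X ^ p.length) := by
      rw [map_sum]
      refine Finset.sum_congr rfl fun p _ => ?_
      rw [Polynomial.smul_eq_C_mul, Polynomial.toLaurent_C_mul_X_pow,
        LaurentPolynomial.smul_eq_C_mul]
    rw [hpoly, Polynomial.toLaurent_ne_zero]
    intro h
    have h' := congrArg (fun f => Polynomial.coeff f 0) h
    simp only [Polynomial.finsetSum_coeff, Polynomial.coeff_smul, Polynomial.coeff_X_pow,
      Polynomial.coeff_zero] at h'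
    rw [Finset.sum_eq_single []] at h'
    · exact hc.1 (by simpa using h')
    · intro p _ hp
      rw [if_neg (by simpa [eq_comm] using hp), smul_zero]
    · intro h
      rw [Finsupp.notMem_support_iff.mp h, zero_smul]
  -- Evaluation at T = 1 shows that 1 - T^n is not a unit.
  have hT : ∀ a : K[T;T⁻¹], (1 - LaurentPolynomial.T (q.length : ℤ)) * a ≠ 1 := by
    intro a h
    have h' := congrArg (LaurentPolynomial.eval₂ (RingHom.id K) 1) h
    rw [map_mul, map_sub, map_one, LaurentPolynomial.eval₂_T] at h'
    simp at h'
  have h1 : (1 - LaurentPolynomial.T (q.length : ℤ) : K[T;T⁻¹]) ≠ 0 := by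
    rw [sub_ne_zero, ← LaurentPolynomial.T_zero]
    intro h
    have h' := congrArg LaurentPolynomial.degree h
    rw [LaurentPolynomial.degree_T, LaurentPolynomial.degree_T] at h'
    exact hq₀ (List.length_eq_zero_iff.mp (by exact_mod_cast h'.symm))
  have hcomb : ρ (comb K G w c) (Finsupp.single (w, Sum.inr 0) 1) = Finsupp.single (w, Sum.inr 0) P := by
    rw [comb_apply, map_sum, LinearMap.sum_apply, Finsupp.single_finsetSum]
    refine Finset.sum_congr rfl fun p hp => ?_
    rw [hρ, LinearMap.smul_apply, hpath w p w (hc.2 p hp) hb, one_mul, Finsupp.smul_single]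
  have hdiff : ρ ((vx K G w - real K G q w) * comb K G w c) (Finsupp.single (w, Sum.inr 0) 1) =
      ((1 - LaurentPolynomial.T (q.length : ℤ)) * P) • Finsupp.single (w, Sum.inr 0) 1 := by
    rw [map_mul, Module.End.mul_apply, hcomb, map_sub, LinearMap.sub_apply, hvx,
      hpath w q w hq hb, ← Finsupp.single_sub, Finsupp.smul_single, smul_eq_mul]
    congr 1
    ring
  constructor
  · intro h
    have h' := congrArg (fun z => ρ z (Finsupp.single (w, Sum.inr 0) 1) (w, Sum.inr 0)) h
    rw [map_mul, Module.End.mul_apply, hdiff, map_smul, hcomb, Finsupp.single_eq_same,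
      Finsupp.smul_apply, smul_eq_mul] at h'
    refine hT (ρ y (Finsupp.single (w, Sum.inr 0) 1) (w, Sum.inr 0)) (mul_right_cancel₀ hP ?_)
    rw [one_mul, mul_right_comm, h']
  · intro h
    rw [h, map_zero, LinearMap.zero_apply, eq_comm, Finsupp.smul_single, smul_eq_mul, mul_one,
      Finsupp.single_eq_zero] at hdiff
    exact mul_ne_zero h1 hP hdiff

end LeavittPathAlgebra

end

/-! ### Minimal left ideals in a ring without unit. -/

section LeftIdeal

variable {R : Type*} [NonUnitalRing R]

/-- The left ideal of left multiples of an element. -/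
def leftMultiples (x : R) : AddSubgroup R := (AddMonoidHom.mulRight x).range

theorem isLeftIdeal_leftMultiples (x : R) : IsLeftIdeal (leftMultiples x) := by
  rintro a _ ⟨b, rfl⟩
  exact ⟨a * b, mul_assoc a b x⟩

/-- Without a unit, x need not lie in Rx; the local left unit `u` ensures that Rx ≠ 0, hence Rx = I.
-/
theorem IsMinimalLeftIdeal.exists_mul_eq {I : AddSubgroup R} (hI : IsMinimalLeftIdeal I) {x z : R}
    (hx : x ∈ I) (hz : z ∈ I) (hx₀ : x ≠ 0) (hu : ∃ u, u * x = x) : ∃ a, a * x = z := by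
  have hle : leftMultiples x ≤ I := by
    rintro _ ⟨a, rfl⟩
    exact hI.1 a x hx
  rcases hI.2.2 _ (isLeftIdeal_leftMultiples x) hle with h | h
  · have : x ∈ leftMultiples x := hu
    rw [h] at this
    exact absurd this hx₀
  · rwa [← h] at hz

/-- Right multiplication maps a minimal left ideal to zero or to a minimal left ideal. -/
theorem IsMinimalLeftIdeal.map_mulRight {I : AddSubgroup R} (hI : IsMinimalLeftIdeal I) {b x : R}
    (hx : x ∈ I) (hxb : x * b ≠ 0) : IsMinimalLeftIdeal (I.map (AddMonoidHom.mulRight b)) := by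
  refine ⟨?_, ?_, ?_⟩
  · rintro a _ ⟨y, hy, rfl⟩
    exact ⟨a * y, hI.1 a y hy, mul_assoc a y b⟩
  · intro h
    have : x * b ∈ I.map (AddMonoidHom.mulRight b) := ⟨x, hx, rfl⟩
    rw [h] at this
    exact hxb this
  · intro J hJ hJI
    have hideal : IsLeftIdeal (I ⊓ J.comap (AddMonoidHom.mulRight b)) := by
      rintro a y ⟨hy, hyb⟩
      refine ⟨hI.1 a y hy, ?_⟩
      change a * y * b ∈ J
      rw [mul_assoc]
      exact hJ a _ hyb
    rcases hI.2.2 _ hideal inf_le_left with h | h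
    · left
      rw [eq_bot_iff]
      intro z hz
      obtain ⟨y, hy, rfl⟩ := hJI hz
      have : y ∈ I ⊓ J.comap (AddMonoidHom.mulRight b) := ⟨hy, hz⟩
      rw [h, AddSubgroup.mem_bot] at this
      rw [this, map_zero]
      exact AddSubgroup.zero_mem _
    · right
      refine le_antisymm hJI ?_
      rintro _ ⟨y, hy, rfl⟩
      exact (inf_eq_left.mp h) hy

theorem ringSocle_ne_bot_iff : ringSocle R ≠ ⊥ ↔ ∃ I : AddSubgroup R, IsMinimalLeftIdeal I := by
  constructor
  · contrapose!
    intro h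
    rw [ringSocle, sSup_eq_bot]
    exact fun I hI => absurd hI (h I)
  · rintro ⟨I, hI⟩ h
    exact hI.2.1 (le_bot_iff.mp (h ▸ le_sSup hI))

end LeftIdeal

/-! ### Minimal left ideals and line points. -/

namespace LeavittPathAlgebra

variable {K : Type*} [Field K] {V E : Type*} {G : DirGraph V E}

/-- If z were in I, the nonzero element (w - q)z would generate I, making z a left multiple of it,
against `IsClosedComb.ne_mul`. -/
theorem not_mem_minimal_of_closed {I : AddSubgroup (LeavittPathAlgebra K G)}
    (hI : IsMinimalLeftIdeal I) {w : V} {c : List E →₀ K} (hc : IsClosedComb G w c)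
    (hb : ∀ x ∈ G.tree w, ¬ G.IsBifurcation x) {q : List E} (hq₀ : q ≠ [])
    (hq : G.IsPath w q w) : comb K G w c ∉ I := by
  intro hz
  have hne := hc.ne_mul hb hq₀ hq
  obtain ⟨a, ha⟩ := hI.exists_mul_eq (hI.1 _ _ hz) hz (hne 0).2
    ⟨vx K G w, by rw [← mul_assoc, mul_sub, vx_mul_self, vx_mul_real hq]⟩
  exact (hne a).1 ha

theorem isClosedComb_single (w : V) {k : K} (hk : k ≠ 0) :
    IsClosedComb G w (Finsupp.single ([] : List E) k) := by
  refine ⟨by simpa using hk, fun p hp => ?_⟩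
  have := Finsupp.support_single_subset hp
  rw [Finset.mem_singleton.mp this]
  rfl

theorem comb_single (w : V) (k : K) :
    comb K G w (Finsupp.single [] k) = k • vx K G w := by simp [comb]

/-- A vertex in a minimal left ideal is a line point. -/
theorem mem_linePoints_of_vx_mem {I : AddSubgroup (LeavittPathAlgebra K G)}
    (hI : IsMinimalLeftIdeal I) {v : V} (hv : vx K G v ∈ I) : v ∈ G.linePoints := by
  -- Right multiplication by a path p from v to x carries I to a minimal left ideal, which contains
  -- x = p*(vp).
  have transport : ∀ x ∈ G.tree v, ∃ J : AddSubgroup (LeavittPathAlgebra K G),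
      IsMinimalLeftIdeal J ∧ vx K G x ∈ J := by
    rintro x ⟨p, hp⟩
    have hne : vx K G v * real K G p x ≠ 0 := by
      rw [vx_mul_real hp]
      intro h
      have := ghost_mul_real_self (K := K) hp
      rw [h, mul_zero] at this
      exact vx_ne_zero x this.symm
    have hJ := hI.map_mulRight hv hne
    refine ⟨_, hJ, ?_⟩
    rw [← ghost_mul_real_self hp]
    exact hJ.1 _ _ ⟨_, hv, vx_mul_real hp⟩
  have nobif : ∀ x ∈ G.tree v, ¬ G.IsBifurcation x := by
    rintro x hx ⟨e, he, f, hf, hef⟩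
    obtain ⟨J, hJ, hxJ⟩ := transport x hx
    have hx' : vx K G x * ed K G e = ed K G e := by rw [← show G.s e = x from he, vx_mul_ed]
    have hmem : ed K G e * gh K G e ∈ J := by
      have := hJ.1 (ed K G e * gh K G e) _ hxJ
      rwa [← show G.s e = x from he, mul_assoc, gh_mul_vx] at this
    have hne : ed K G e * gh K G e ≠ 0 := by
      intro h
      apply vx_ne_zero (K := K) (G := G) (G.r e)
      have : gh K G e * (ed K G e * gh K G e) * ed K G e = vx K G (G.r e) := by
        rw [← mul_assoc, gh_mul_ed, vx_mul_gh, gh_mul_ed]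
      rw [← this, h, mul_zero, zero_mul]
    -- Minimality gives x = aee*, whence f = xf = aee*f = 0.
    obtain ⟨a, ha⟩ := hJ.exists_mul_eq hmem hxJ hne ⟨_, by rw [← mul_assoc, hx']⟩
    apply vx_ne_zero (K := K) (G := G) (G.r f)
    rw [← gh_mul_ed, ← vx_mul_ed f, show G.s f = x from hf, ← ha, mul_assoc, mul_assoc,
      gh_mul_ed_of_ne hef, mul_zero, mul_zero, mul_zero]
  refine fun x hx => ⟨nobif x hx, ?_⟩
  rintro ⟨q, hq₀, hq, -⟩
  obtain ⟨J, hJ, hxJ⟩ := transport x hx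
  refine not_mem_minimal_of_closed hJ (isClosedComb_single x one_ne_zero)
    (fun y hy => nobif y (DirGraph.tree_subset hx hy)) hq₀ hq ?_
  rwa [comb_single, one_smul]

theorem nonempty_linePoints {I : AddSubgroup (LeavittPathAlgebra K G)}
    (hI : IsMinimalLeftIdeal I) : G.linePoints.Nonempty := by
  obtain ⟨x, hx, hx₀⟩ := I.bot_or_exists_ne_zero.resolve_left hI.2.1
  obtain ⟨a, b, w, c, h, hc, hr⟩ := exists_reduced hx₀
  have single : ∀ k : K, k ≠ 0 → c = Finsupp.single [] k → G.linePoints.Nonempty := by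
    rintro k hk rfl
    rw [comb_single] at h
    have hne : a * x * b ≠ 0 := by
      rw [h]
      exact smul_ne_zero hk (vx_ne_zero w)
    have hJ := hI.map_mulRight (hI.1 a x hx) hne
    refine ⟨w, mem_linePoints_of_vx_mem hJ ?_⟩
    have := hJ.1 (k⁻¹ • vx K G w) (a * x * b) ⟨_, hI.1 a x hx, rfl⟩
    rwa [h, smul_mul_assoc, mul_smul_comm, vx_mul_self, inv_smul_smul₀ hk] at this
  rcases hr with hb | ⟨k, hk, hck⟩
  · by_cases hq : ∃ q, q ≠ [] ∧ G.IsPath w q w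
    · obtain ⟨q, hq₀, hq⟩ := hq
      have hne : a * x * b ≠ 0 := by
        intro h₀
        apply (hc.ne_mul hb hq₀ hq 0).2
        rw [← h, h₀, mul_zero]
      refine absurd ?_ (not_mem_minimal_of_closed (hI.map_mulRight (hI.1 a x hx) hne) hc hb hq₀ hq)
      rw [← h]
      exact ⟨_, hI.1 a x hx, rfl⟩
    · push Not at hq
      obtain ⟨k, hk, hck⟩ := hc.eq_single fun p hp => by
        by_contra hp₀
        exact hq p hp₀ (hc.2 p hp)
      exact single k hk hck
  · exact single k hk hck

theorem ed_mul_gh {e : E} (hb : ¬ G.IsBifurcation (G.s e)) :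
    ed K G e * gh K G e = vx K G (G.s e) := by
  have hsub : (G.s ⁻¹' {G.s e}).Subsingleton := Set.not_nontrivial_iff.mp hb
  have he : e ∈ G.s ⁻¹' {G.s e} := rfl
  have hr : G.IsRegular (G.s e) := ⟨fun h => by
    rw [DirGraph.IsSink] at h
    rw [h] at he
    exact he, Set.not_infinite.mpr hsub.finite⟩
  rw [vx_eq_sum hr, Finset.sum_eq_single e]
  · exact fun f hf hfe => absurd (DirGraph.eq_of_not_isBifurcation hb (by simpa using hf) rfl) hfe
  · exact fun h => absurd (by simp) h

/-- Without bifurcations each regular relation has the single term ee*, so the ghost path is a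
two-sided inverse of the path. -/
theorem real_mul_ghost {u w : V} {p : List E} (hp : G.IsPath u p w)
    (hb : ∀ x ∈ G.tree u, ¬ G.IsBifurcation x) : real K G p w * ghost K G p w = vx K G u := by
  induction p generalizing u with
  | nil => cases hp; simp
  | cons e p ih =>
    obtain ⟨rfl, hp⟩ := hp
    have := ih hp fun x hx => hb x (DirGraph.tree_subset (DirGraph.range_mem_tree e) hx)
    rw [real_cons, ghost_cons, mul_assoc, ← mul_assoc (real K G p w), this, vx_mul_gh,
      ed_mul_gh (hb _ (DirGraph.self_mem_tree _))]

/-- A line point generates a minimal left ideal. -/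
theorem isMinimalLeftIdeal_of_mem_linePoints {v : V} (hv : v ∈ G.linePoints) :
    IsMinimalLeftIdeal (leftMultiples (vx K G v)) := by
  refine ⟨isLeftIdeal_leftMultiples _, fun h => ?_, fun J hJ hJv => ?_⟩
  · have : vx K G v ∈ leftMultiples (vx K G v) := ⟨_, vx_mul_self v⟩
    rw [h] at this
    exact vx_ne_zero v this
  · refine J.bot_or_exists_ne_zero.imp_right fun ⟨x, hx, hx₀⟩ => le_antisymm hJv ?_
    have hxv : x * vx K G v = x := by
      obtain ⟨y, rfl⟩ := hJv hx
      change y * vx K G v * vx K G v = y * vx K G v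
      rw [mul_assoc, vx_mul_self]
    obtain ⟨p, w, c, hp, hc, h⟩ := exists_mul_real_eq_comb hxv hx₀
    obtain ⟨a, c', ha, hc'⟩ := hc.exists_isClosedComb
    -- A nontrivial closed path at w would produce a cycle in the tree of v, so only the scalar part
    -- survives.
    obtain ⟨k, hk, rfl⟩ := hc'.eq_single fun q hq => by
      by_contra hq₀
      obtain ⟨y, hy, hcyc⟩ := DirGraph.exists_cycle_of_closed hq₀ (hc'.2 q hq)
      exact (hv y (DirGraph.tree_subset ⟨p, hp⟩ hy)).2 hcyc
    rw [comb_single, ← h] at ha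
    -- From a(xp) = kw follows pa(xp)p* = k pp* = kv, while xpp* = xv = x.
    have key : (k⁻¹ • (real K G p w * a)) * x = vx K G v := by
      have hg := real_mul_ghost (K := K) hp fun x hx => (hv x hx).1
      calc (k⁻¹ • (real K G p w * a)) * x
          = k⁻¹ • (real K G p w * (a * (x * real K G p w)) * ghost K G p w) := by
            nth_rewrite 1 [← hxv]
            rw [← hg]
            simp only [smul_mul_assoc, mul_assoc]
        _ = vx K G v := by
            rw [ha, mul_smul_comm, real_mul_vx, smul_mul_assoc, hg, inv_smul_smul₀ hk]
    rintro _ ⟨b, rfl⟩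
    refine hJ b _ ?_
    rw [← key]
    exact hJ _ _ hx

end LeavittPathAlgebra

theorem mainTheorem5 (K : Type*) [Field K] {V E : Type*} (G : DirGraph V E) :
    ringSocle (LeavittPathAlgebra K G) ≠ ⊥ ↔ G.linePoints.Nonempty := by
  rw [ringSocle_ne_bot_iff]
  constructor
  · rintro ⟨I, hI⟩
    exact LeavittPathAlgebra.nonempty_linePoints hI
  · rintro ⟨v, hv⟩
    exact ⟨_, LeavittPathAlgebra.isMinimalLeftIdeal_of_mem_linePoints hv⟩
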